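/- Let $\mathbb{P}_{\mathbb{N}}$ be the group of permutations of $\mathbb{N}$ that move only finitely many points. A quasi-local algebra is a unital C*-algebra $\mathfrak{A}$ with an involutive $*$-automorphism $\theta$ and a net of unital C*-subalgebras $\mathfrak{A}(I)\subset\mathfrak{A}$, indexed by the finite subsets $I\subset\mathbb{N}$, such that $\bigcup_I\mathfrak{A}(I)$ is dense in $\mathfrak{A}$; $\mathfrak{A}(I)\subset\mathfrak{A}(J)$ if $I\subset J$; $\theta(\mathfrak{A}(I))=\mathfrak{A}(I)$; and, if $I\cap J=\emptyset$, homogeneous elements $x\in\mathfrak{A}(I)$, $y\in\mathfrak{A}(J)$ (that is, $\theta(x)=\pm x$, $\theta(y)=\pm y$) commute when one of them is even (fixed by $\theta$) and anticommute when both are odd (changed in sign by $\theta$). A local action of $\mathbb{P}_{\mathbb{N}}$ on $\mathfrak{A}$ is a homomorphism $\alpha:\mathbb{P}_{\mathbb{N}}\to\mathrm{Aut}(\mathfrak{A})$ into the $*$-automorphisms such that $\alpha_\sigma\circ\theta=\theta\circ\alpha_\sigma$ and $\alpha_\sigma(\mathfrak{A}(I))=\mathfrak{A}(\sigma(I))$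 for all $\sigma\in\mathbb{P}_{\mathbb{N}}$ and all finite $I$, and such that, whenever $\sigma$ restricts to the identity on $\{s,s+1,\dots\}$, $\alpha_\sigma$ is the identity on $\mathfrak{A}(J)$ for every finite $J\subset\{s,s+1,\dots\}$. Let $\alpha$ be a local action of $\mathbb{P}_{\mathbb{N}}$ on a quasi-local algebra $\mathfrak{A}$, and let $\omega$ be an extreme point of the convex set of states of $\mathfrak{A}$ that are invariant under all $\alpha_\sigma$. Let $(\mathcal{H}_\omega,\pi_\omega,\xi_\omega)$ be the GNS triple of $\omega$. Then the tail algebra (algebra at infinity) $$\mathfrak{Z}^\perp_\omega=\bigcap_{n}\ \bigvee_{I\subset\{n,n+1,\dots\},\ I\text{ finite}}\pi_\omega(\mathfrak{A}(I))''$$ is trivial: $\mathfrak{Z}^\perp_\omega=\mathbb{C}1_{\mathcal{H}_\omega}$. -/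

import Mathlib

open scoped ComplexOrder

/-- The group of finite permutations of `ℕ`: those moving only finitely many points. -/
def finitePerm : Subgroup (Equiv.Perm ℕ) where
  carrier := {σ | {n | σ n ≠ n}.Finite}
  one_mem' := by simp
  mul_mem' := by
    intro σ τ hσ hτ
    refine (Set.Finite.union hσ hτ).subset ?_
    intro n hn
    by_contra h
    simp only [Set.mem_union, Set.mem_ofPred_eq, not_or, not_not] at h
    exact hn (by simp [h.1, h.2])
  inv_mem' := by
    intro σ hσ
    refine Set.Finite.subset hσ ?_
    intro n hn h
    exact hn (Equiv.Perm.inv_eq_iff_eq.mpr h.symm)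

/-- The structure of a quasi-local algebra over the finite subsets of `ℕ` on a unital
C⋆-algebra `A`: an involutive ⋆-automorphism `θ` (the grading) and an isotone net of closed
unital ⋆-subalgebras, stable under `θ`, with dense union, such that homogeneous elements localized
in disjoint sets commute when one of them is even, and anticommute when both are odd. -/
structure QuasiLocal (A : Type*) [CStarAlgebra A] where
  /-- the grading automorphism -/
  θ : A ≃⋆ₐ[ℂ] A
  θ_θ : ∀ a, θ (θ a) = a
  /-- the local algebras -/
  loc : Finset ℕ → StarSubalgebra ℂ A
  isClosed_loc : ∀ I, IsClosed (loc I : Set A)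
  mono_loc : ∀ I J, I ⊆ J → loc I ≤ loc J
  dense_loc : Dense (⋃ I, (loc I : Set A))
  image_θ_loc : ∀ I, θ '' (loc I : Set A) = (loc I : Set A)
  /-- an even element commutes with every homogeneous one localized in a disjoint set -/
  even_commute : ∀ I J, Disjoint I J → ∀ x ∈ loc I, ∀ y ∈ loc J,
    θ x = x → (θ y = y ∨ θ y = -y) → x * y = y * x
  /-- odd elements localized in disjoint sets anticommute -/
  odd_anticommute : ∀ I J, Disjoint I J → ∀ x ∈ loc I, ∀ y ∈ loc J,
    θ x = -x → θ y = -y → x * y = -(y * x)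

/-- Local actions of the finite permutations on a quasi-local algebra. -/
structure QuasiLocal.IsLocalAction {A : Type*} [CStarAlgebra A] (Q : QuasiLocal A)
    (α : finitePerm →* (A ≃⋆ₐ[ℂ] A)) : Prop where
  /-- the action is grading-equivariant -/
  equivariant : ∀ σ a, α σ (Q.θ a) = Q.θ (α σ a)
  /-- `α σ` maps `A(I)` onto `A(σ(I))` -/
  image_loc : ∀ (σ : finitePerm) (I : Finset ℕ),
    α σ '' (Q.loc I : Set A) = (Q.loc (I.map (σ : Equiv.Perm ℕ).toEmbedding) : Set A)
  /-- if `σ` is the identity on `{s, s+1, …}`, then `α σ` is the identity on every `A(J)`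
  with `J ⊆ {s, s+1, …}` -/
  trivial_of_fixed : ∀ (σ : finitePerm) (s : ℕ), (∀ n, s ≤ n → (σ : Equiv.Perm ℕ) n = n) →
    ∀ J : Finset ℕ, (∀ j ∈ J, s ≤ j) → ∀ a ∈ Q.loc J, α σ a = a

/-- The set of symmetric (that is, invariant) states, as a subset of the complex vector space of
linear functionals on `A`. -/
def symmetricStates {A : Type*} [CStarAlgebra A] [PartialOrder A] [StarOrderedRing A]
    (α : finitePerm →* (A ≃⋆ₐ[ℂ] A)) : Set (A →ₗ[ℂ] ℂ) :=
  {φ | (∀ a, 0 ≤ a → 0 ≤ φ a) ∧ φ 1 = 1 ∧ ∀ σ a, φ (α σ a) = φ a}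

section VonNeumann

variable {H : Type*} [NormedAddCommGroup H] [InnerProductSpace ℂ H] [CompleteSpace H]

/-- The von Neumann algebra generated by a set of operators: the bicommutant of the union of the
set with the set of its adjoints. -/
noncomputable def vonNeumannGenerated (S : Set (H →L[ℂ] H)) : VonNeumannAlgebra H where
  toStarSubalgebra :=
    StarSubalgebra.centralizer ℂ (StarSubalgebra.centralizer ℂ S : Set (H →L[ℂ] H))
  centralizer_centralizer' := by
    change Set.centralizer (Set.centralizer ((StarSubalgebra.centralizer ℂ
      (StarSubalgebra.centralizer ℂ S : Set (H →L[ℂ] H)) : StarSubalgebra ℂ (H →L[ℂ] H)) :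
        Set (H →L[ℂ] H))) = ((StarSubalgebra.centralizer ℂ
      (StarSubalgebra.centralizer ℂ S : Set (H →L[ℂ] H)) : StarSubalgebra ℂ (H →L[ℂ] H)) :
        Set (H →L[ℂ] H))
    rw [StarSubalgebra.coe_centralizer_centralizer, Set.centralizer_centralizer_centralizer]

/-- The intersection of a family of von Neumann algebras. -/
noncomputable def vonNeumannInter {ι : Sort*} (M : ι → VonNeumannAlgebra H) :
    VonNeumannAlgebra H where
  toStarSubalgebra := ⨅ i, (M i).toStarSubalgebra
  centralizer_centralizer' := by
    change Set.centralizer (Set.centralizer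
      ((⨅ i, (M i).toStarSubalgebra : StarSubalgebra ℂ (H →L[ℂ] H)) : Set (H →L[ℂ] H)))
      = ((⨅ i, (M i).toStarSubalgebra : StarSubalgebra ℂ (H →L[ℂ] H)) : Set (H →L[ℂ] H))
    refine Set.Subset.antisymm ?_ Set.subset_centralizer_centralizer
    rw [StarSubalgebra.coe_iInf]
    refine Set.subset_iInter fun i => ?_
    have h := (M i).centralizer_centralizer
    rw [← VonNeumannAlgebra.coe_toStarSubalgebra] at h
    refine Set.Subset.trans ?_ h.subset
    exact Set.centralizer_subset (Set.centralizer_subset (Set.iInter_subset _ i))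

end VonNeumann

/-- The tail algebra (algebra at infinity) of a positive functional `ω`: with `π` the GNS
representation of `ω`, the intersection over `n` of the von Neumann algebras generated by all
`π(A(I))''` with `I` a finite subset of `{n, n+1, …}`. -/
noncomputable def QuasiLocal.tailAlgebra {A : Type*} [CStarAlgebra A] [PartialOrder A]
    [StarOrderedRing A] (Q : QuasiLocal A) (ω : A →ₚ[ℂ] ℂ) : VonNeumannAlgebra ω.GNS :=
  vonNeumannInter fun n : ℕ => vonNeumannGenerated
    (⋃ (I : Finset ℕ) (_ : ∀ i ∈ I, n ≤ i),
      (vonNeumannGenerated (ω.gnsStarAlgHom '' (Q.loc I : Set A)) : Set (ω.GNS →L[ℂ] ω.GNS)))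

/-! Invariant states are even (`map_θ_of_invariant`), since an odd local element has infinitely many
pairwise anticommuting translates, whose sums grow only like `√n`. Hence the GNS space carries a
selfadjoint unitary `W` implementing `θ`, besides the operators `U_σ` implementing `α σ`.

Let `T` be selfadjoint in the tail algebra. Far from a finite set, local elements commute with
`π(x)` for `x` even, with `π(x)W` for `x` odd, and with `U_σ`; so `T` commutes with all of these.
The obstruction to `T ∈ π(A)'` is `D = T - WTW`. It anticommutes with `W`, and `DW` lies in `π(A)'`,
hence commutes with `T`; this forces `D² = 0`, so `D = 0`. Thus `T` commutes with `π(A)` and every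
`U_σ`, and extremality makes it a scalar (`exists_eq_smul_one_of_extremal`). -/

open scoped InnerProductSpace
open UniformSpace

/-! ### GNS space: implementing operators and perturbed functionals -/

namespace PositiveLinearMap

variable {A : Type*} [CStarAlgebra A] [PartialOrder A] [StarOrderedRing A] (ω : A →ₚ[ℂ] ℂ)

/-- The image of `a` in the GNS space. -/
noncomputable def gnsVec (a : A) : ω.GNS := ((ω.toPreGNS a : ω.PreGNS) : ω.GNS)

lemma gnsStarAlgHom_gnsVec (a b : A) : ω.gnsStarAlgHom a (ω.gnsVec b) = ω.gnsVec (a * b) := by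
  simp [gnsVec]

lemma inner_gnsVec (a b : A) : ⟪ω.gnsVec a, ω.gnsVec b⟫_ℂ = ω (star a * b) := by
  simp [gnsVec, Completion.inner_coe, preGNS_inner_def]

lemma ext_gnsVec {S T : ω.GNS →L[ℂ] ω.GNS} (h : ∀ a, S (ω.gnsVec a) = T (ω.gnsVec a)) : S = T := by
  ext x
  induction x using Completion.induction_on with
  | hp => exact isClosed_eq S.continuous T.continuous
  | ih x => exact h (ω.ofPreGNS x)

lemma ext_inner_gnsVec {S T : ω.GNS →L[ℂ] ω.GNS}
    (h : ∀ a b, ⟪ω.gnsVec a, S (ω.gnsVec b)⟫_ℂ = ⟪ω.gnsVec a, T (ω.gnsVec b)⟫_ℂ) : S = T := by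
  refine ω.ext_gnsVec fun b => ext_inner_left ℂ fun x => ?_
  induction x using Completion.induction_on with
  | hp => apply isClosed_eq <;> fun_prop
  | ih x => exact h (ω.ofPreGNS x) b

/-- The isometry on the pre-GNS space induced by an automorphism preserving the functional. -/
noncomputable def preCovariance (g : A ≃⋆ₐ[ℂ] A) (hg : ∀ a, ω (g a) = ω a) :
    ω.PreGNS →ₗᵢ[ℂ] ω.PreGNS where
  toLinearMap := ω.toPreGNS.toLinearMap ∘ₗ (g : A →ₗ[ℂ] A) ∘ₗ ω.ofPreGNS.toLinearMap
  norm_map' x := by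
    simp only [preGNS_norm_def]
    congr 2
    change ω (star (g (ω.ofPreGNS x)) * g (ω.ofPreGNS x)) = _
    rw [← map_star, ← map_mul, hg]

/-- The operator on the GNS space implementing an automorphism that preserves the functional. -/
noncomputable def covariance (g : A ≃⋆ₐ[ℂ] A) (hg : ∀ a, ω (g a) = ω a) : ω.GNS →L[ℂ] ω.GNS :=
  (ω.preCovariance g hg).toContinuousLinearMap.completion

variable {ω} {g : A ≃⋆ₐ[ℂ] A} (hg : ∀ a, ω (g a) = ω a)

lemma covariance_gnsVec (a : A) : ω.covariance g hg (ω.gnsVec a) = ω.gnsVec (g a) := by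
  simp only [covariance, gnsVec, ContinuousLinearMap.completion_apply_coe]
  rfl

lemma inner_covariance (x y : ω.GNS) :
    ⟪ω.covariance g hg x, ω.covariance g hg y⟫_ℂ = ⟪x, y⟫_ℂ := by
  induction x, y using Completion.induction_on₂ with
  | hp => apply isClosed_eq <;> fun_prop
  | ih x y =>
    change ⟪ω.covariance g hg (ω.gnsVec (ω.ofPreGNS x)),
      ω.covariance g hg (ω.gnsVec (ω.ofPreGNS y))⟫_ℂ =
        ⟪ω.gnsVec (ω.ofPreGNS x), ω.gnsVec (ω.ofPreGNS y)⟫_ℂ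
    rw [covariance_gnsVec, covariance_gnsVec, inner_gnsVec, inner_gnsVec, ← map_star, ← map_mul, hg]

lemma covariance_mul_gnsStarAlgHom (a : A) :
    ω.covariance g hg * ω.gnsStarAlgHom a = ω.gnsStarAlgHom (g a) * ω.covariance g hg := by
  refine ω.ext_gnsVec fun b => ?_
  simp only [mul_apply_eq_comp, gnsStarAlgHom_gnsVec, covariance_gnsVec, map_mul]

lemma covariance_mul_self (h : ∀ a, g (g a) = a) :
    ω.covariance g hg * ω.covariance g hg = 1 := by
  refine ω.ext_gnsVec fun b => ?_
  simp [covariance_gnsVec, h]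

lemma isSelfAdjoint_covariance (h : ∀ a, g (g a) = a) : IsSelfAdjoint (ω.covariance g hg) := by
  rw [ContinuousLinearMap.isSelfAdjoint_iff_isSymmetric]
  intro x y
  have h2 : ω.covariance g hg (ω.covariance g hg x) = x := by
    rw [← mul_apply_eq_comp, covariance_mul_self hg h, one_apply_eq_self]
  have := inner_covariance hg (ω.covariance g hg x) y
  rw [h2] at this
  exact this.symm

/-- The functional `a ↦ ⟪ξ, (1 + T) π(a) ξ⟫` obtained from `ω` by an operator `T`. -/
noncomputable def perturb (ω : A →ₚ[ℂ] ℂ) (T : ω.GNS →L[ℂ] ω.GNS) : A →ₗ[ℂ] ℂ where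
  toFun a := ω a + ⟪ω.gnsVec 1, T (ω.gnsVec a)⟫_ℂ
  map_add' a b := by
    have : ω.gnsVec (a + b) = ω.gnsVec a + ω.gnsVec b := by simp [gnsVec, Completion.coe_add]
    rw [this, map_add, map_add, inner_add_right]; ring
  map_smul' c a := by
    have : ω.gnsVec (c • a) = c • ω.gnsVec a := by simp [gnsVec, Completion.coe_smul]
    rw [this, map_smul, map_smul, inner_smul_right]; simp [mul_add]

lemma perturb_apply (T : ω.GNS →L[ℂ] ω.GNS) (a : A) :
    ω.perturb T a = ω a + ⟪ω.gnsVec 1, T (ω.gnsVec a)⟫_ℂ := rfl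

/-- An operator in `π(A)'` is determined by the functional it induces through the cyclic vector. -/
lemma inner_of_commute {T : ω.GNS →L[ℂ] ω.GNS} (hT : ∀ a, Commute T (ω.gnsStarAlgHom a))
    (a b : A) : ⟪ω.gnsVec a, T (ω.gnsVec b)⟫_ℂ = ⟪ω.gnsVec 1, T (ω.gnsVec (star a * b))⟫_ℂ := by
  rw [← gnsStarAlgHom_gnsVec ω (star a) b, ← mul_apply_eq_comp, (hT _).eq,
    mul_apply_eq_comp, map_star, ContinuousLinearMap.star_eq_adjoint,
    ContinuousLinearMap.adjoint_inner_right, gnsStarAlgHom_gnsVec, mul_one]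

/-- At `star b * b` the value is `‖v‖² + ⟪v, T v⟫` with `v` the vector of `b`, and Cauchy–Schwarz
bounds the second term by the first. -/
lemma perturb_nonneg {T : ω.GNS →L[ℂ] ω.GNS} (hT : ∀ a, Commute T (ω.gnsStarAlgHom a))
    (hsa : IsSelfAdjoint T) (hn : ‖T‖ ≤ 1) (a : A) (ha : 0 ≤ a) : 0 ≤ ω.perturb T a := by
  obtain ⟨b, rfl⟩ := CStarAlgebra.nonneg_iff_eq_star_mul_self.mp ha
  rw [perturb_apply, ← inner_of_commute hT, ← inner_gnsVec]
  have hsym := (ContinuousLinearMap.isSelfAdjoint_iff_isSymmetric.mp hsa)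
  have him : (⟪ω.gnsVec b, T (ω.gnsVec b)⟫_ℂ).im = 0 := by
    have h1 := hsym (ω.gnsVec b) (ω.gnsVec b)
    have h2 := inner_conj_symm (𝕜 := ℂ) (ω.gnsVec b) (T (ω.gnsVec b))
    rw [ContinuousLinearMap.coe_coe] at h1
    rw [h1] at h2
    exact Complex.conj_eq_iff_im.mp h2
  have hre : |(⟪ω.gnsVec b, T (ω.gnsVec b)⟫_ℂ).re| ≤ ‖ω.gnsVec b‖ ^ 2 := by
    calc _ ≤ ‖⟪ω.gnsVec b, T (ω.gnsVec b)⟫_ℂ‖ := Complex.abs_re_le_norm _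
      _ ≤ ‖ω.gnsVec b‖ * ‖T (ω.gnsVec b)‖ := norm_inner_le_norm _ _
      _ ≤ ‖ω.gnsVec b‖ * ‖ω.gnsVec b‖ := by
        gcongr
        simpa using T.le_of_opNorm_le hn (ω.gnsVec b)
      _ = _ := by ring
  rw [inner_self_eq_norm_sq_to_K, Complex.nonneg_iff]
  simp only [Complex.add_re, Complex.add_im, him, Complex.coe_algebraMap]
  rw [← Complex.ofReal_pow, Complex.ofReal_re, Complex.ofReal_im]
  constructor
  · linarith [(abs_le.mp hre).1]
  · simp

end PositiveLinearMap

open PositiveLinearMap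

/-! ### Extremality and the commutant -/

section Extremal

variable {A : Type*} [CStarAlgebra A] [PartialOrder A] [StarOrderedRing A]
  {α : finitePerm →* (A ≃⋆ₐ[ℂ] A)} {ω : A →ₚ[ℂ] ℂ}

lemma perturb_mem_symmetricStates (h1 : ω 1 = 1) (hinv : ∀ σ a, ω (α σ a) = ω a)
    {T : ω.GNS →L[ℂ] ω.GNS} (hT : ∀ a, Commute T (ω.gnsStarAlgHom a))
    (hU : ∀ σ, Commute T (ω.covariance (α σ) (hinv σ)))
    (hsa : IsSelfAdjoint T) (hn : ‖T‖ ≤ 1) (h0 : ⟪ω.gnsVec 1, T (ω.gnsVec 1)⟫_ℂ = 0) :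
    ω.perturb T ∈ symmetricStates α := by
  refine ⟨perturb_nonneg hT hsa hn, by rw [perturb_apply, h1, h0, add_zero], fun σ a => ?_⟩
  rw [perturb_apply, perturb_apply, hinv σ, ← covariance_gnsVec (hinv σ),
    ← mul_apply_eq_comp, (hU σ).eq, mul_apply_eq_comp]
  have : ω.gnsVec 1 = ω.covariance (α σ) (hinv σ) (ω.gnsVec 1) := by
    rw [covariance_gnsVec, map_one]
  conv_lhs => rw [this]
  rw [inner_covariance]

/-- For an extremal symmetric state, the commutant of the GNS representation and the implementing
unitaries is trivial. -/
theorem exists_eq_smul_one_of_extremal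
    (hω : ω.toLinearMap ∈ Set.extremePoints ℝ (symmetricStates α))
    (hinv : ∀ σ a, ω (α σ a) = ω a)
    {T : ω.GNS →L[ℂ] ω.GNS} (hsa : IsSelfAdjoint T) (hT : ∀ a, Commute T (ω.gnsStarAlgHom a))
    (hU : ∀ σ, Commute T (ω.covariance (α σ) (hinv σ))) :
    ∃ c : ℂ, T = c • 1 := by
  have h1 : ω 1 = 1 := hω.1.2.1
  set c : ℂ := ⟪ω.gnsVec 1, T (ω.gnsVec 1)⟫_ℂ with hc
  have hcsa : IsSelfAdjoint (c • (1 : ω.GNS →L[ℂ] ω.GNS)) := by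
    refine IsSelfAdjoint.smul ?_ (IsSelfAdjoint.one _)
    have hsym := (ContinuousLinearMap.isSelfAdjoint_iff_isSymmetric.mp hsa)
    have e1 := hsym (ω.gnsVec 1) (ω.gnsVec 1)
    have e2 := inner_conj_symm (𝕜 := ℂ) (ω.gnsVec 1) (T (ω.gnsVec 1))
    rw [ContinuousLinearMap.coe_coe] at e1
    rw [e1] at e2
    exact e2
  -- Subtracting the expectation keeps the perturbed functionals normalized.
  set R : ω.GNS →L[ℂ] ω.GNS := T - c • 1 with hR
  have hRsa : IsSelfAdjoint R := hsa.sub hcsa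
  have hcomm : ∀ X, Commute T X → Commute R X := fun X hX =>
    hX.sub_left ((Commute.one_left X).smul_left c)
  have hR0 : ⟪ω.gnsVec 1, R (ω.gnsVec 1)⟫_ℂ = 0 := by
    rw [hR, sub_apply, inner_sub_right, ← hc, smul_apply,
      one_apply_eq_self, inner_smul_right, inner_gnsVec, star_one, one_mul, h1,
      mul_one, sub_self]
  obtain ⟨ε, hε, hεn⟩ : ∃ ε : ℝ, 0 < ε ∧ ε * ‖R‖ ≤ 1 := by
    refine ⟨(‖R‖ + 1)⁻¹, by positivity, ?_⟩
    rw [inv_mul_le_iff₀ (by positivity)]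
    linarith
  have key : ∀ t : ℝ, |t| = ε → ω.perturb (t • R) ∈ symmetricStates α := fun t ht => by
    refine perturb_mem_symmetricStates h1 hinv (fun a => (hcomm _ (hT a)).smul_left t)
      (fun σ => (hcomm _ (hU σ)).smul_left t) (IsSelfAdjoint.smul (by simp [IsSelfAdjoint]) hRsa) ?_ ?_
    · rw [norm_smul, Real.norm_eq_abs, ht]; exact hεn
    · simp [inner_smul_right_eq_smul, hR0]
  have hp := key ε (abs_of_pos hε)
  have hm := key (-ε) (by rw [abs_neg, abs_of_pos hε])
  -- `ω` is the midpoint of two invariant states, so extremality makes the perturbation vanish.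
  have hseg : ω.toLinearMap ∈ openSegment ℝ (ω.perturb (ε • R)) (ω.perturb ((-ε) • R)) := by
    refine ⟨1 / 2, 1 / 2, by norm_num, by norm_num, by norm_num, ?_⟩
    ext a
    simp [perturb_apply, inner_smul_right_eq_smul]
    ring
  have heq := hω.2 hp hm hseg
  have hz : ∀ a, ⟪ω.gnsVec 1, R (ω.gnsVec a)⟫_ℂ = 0 := fun a => by
    have := LinearMap.congr_fun heq a
    simpa [perturb_apply, inner_smul_right_eq_smul, hε.ne'] using this
  refine ⟨c, sub_eq_zero.mp (ω.ext_inner_gnsVec (T := 0) fun a b => ?_)⟩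
  rw [← hR, inner_of_commute (fun a => hcomm _ (hT a)), hz]
  simp

end Extremal

/-! ### Permutations moving a block to disjoint copies -/

section Blocks

/-- The map exchanging the blocks `[0, N)` and `[m, m + N)`. -/
def blockSwapFun (N m : ℕ) (n : ℕ) : ℕ :=
  if n < N then n + m else if m ≤ n ∧ n < m + N then n - m else n

/-- The two blocks are disjoint when `N ≤ m`. The case `m = 0` is the identity, kept so that the
original block counts as copy number `0`. -/
lemma blockSwapFun_involutive {N m : ℕ} (h : m = 0 ∨ N ≤ m) :
    Function.Involutive (blockSwapFun N m) := by
  intro n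
  unfold blockSwapFun
  split_ifs <;> omega

/-- The finite permutation exchanging the blocks `[0, N)` and `[m, m + N)`. -/
def blockSwap (N m : ℕ) (h : m = 0 ∨ N ≤ m) : finitePerm :=
  ⟨(blockSwapFun_involutive h).toPerm, by
    refine (Set.finite_lt_nat (m + N)).subset fun n hn => ?_
    change n < m + N
    change blockSwapFun N m n ≠ n at hn
    unfold blockSwapFun at hn
    split_ifs at hn <;> omega⟩

lemma blockSwap_apply {N m : ℕ} (h : m = 0 ∨ N ≤ m) {n : ℕ} (hn : n < N) :
    (blockSwap N m h : Equiv.Perm ℕ) n = n + m := by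
  change blockSwapFun N m n = _
  simp [blockSwapFun, hn]

lemma disjoint_map_blockSwap {N k l : ℕ} (hkl : k ≠ l) {I : Finset ℕ} (hI : ∀ i ∈ I, i < N)
    (hk : k * N = 0 ∨ N ≤ k * N) (hl : l * N = 0 ∨ N ≤ l * N) :
    Disjoint (I.map (blockSwap N (k * N) hk : Equiv.Perm ℕ).toEmbedding)
      (I.map (blockSwap N (l * N) hl : Equiv.Perm ℕ).toEmbedding) := by
  rw [Finset.disjoint_left]
  intro a ha hb
  obtain ⟨i, hi, rfl⟩ := Finset.mem_map.mp ha
  obtain ⟨j, hj, h⟩ := Finset.mem_map.mp hb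
  simp only [Equiv.coe_toEmbedding, blockSwap_apply _ (hI i hi), blockSwap_apply _ (hI j hj)] at h
  have hi' := hI i hi
  have hj' := hI j hj
  rcases lt_or_gt_of_ne hkl with h' | h'
  · have : (k + 1) * N ≤ l * N := Nat.mul_le_mul_right N h'
    rw [add_mul] at this
    omega
  · have : (l + 1) * N ≤ k * N := Nat.mul_le_mul_right N h'
    rw [add_mul] at this
    omega

end Blocks

/-- In `S⋆S + SS⋆` the off-diagonal terms cancel by anticommutation, and this sum dominates `S⋆S`.
-/
lemma norm_sum_sq_le_of_anticommute {A : Type*} [CStarAlgebra A] [PartialOrder A]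
    [StarOrderedRing A] (x : ℕ → A) (B : ℝ) (hB : ∀ k, ‖x k‖ ≤ B)
    (hx : ∀ k l, k ≠ l → star (x k) * x l = -(x l * star (x k))) (n : ℕ) :
    ‖∑ k ∈ Finset.range n, x k‖ ^ 2 ≤ n * (2 * B ^ 2) := by
  set S := ∑ k ∈ Finset.range n, x k with hS
  have h1 : star S * S + S * star S =
      ∑ k ∈ Finset.range n, (star (x k) * x k + x k * star (x k)) := by
    rw [hS, star_sum, Finset.sum_mul_sum, Finset.sum_mul_sum]
    rw [Finset.sum_comm (f := fun i j => x i * star (x j)), ← Finset.sum_add_distrib]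
    refine Finset.sum_congr rfl fun k hk => ?_
    rw [← Finset.sum_add_distrib]
    refine Finset.sum_eq_single_of_mem k hk fun l _ hl => ?_
    rw [hx k l hl.symm, neg_add_cancel]
  calc ‖S‖ ^ 2 = ‖star S * S‖ := by rw [CStarRing.norm_star_mul_self, sq]
    _ ≤ ‖star S * S + S * star S‖ :=
      CStarAlgebra.norm_le_norm_of_nonneg_of_le (star_mul_self_nonneg S)
        (le_add_of_nonneg_right (mul_star_self_nonneg S))
    _ ≤ ∑ k ∈ Finset.range n, (2 * B ^ 2) := by
      rw [h1]
      refine norm_sum_le_of_le _ fun k _ => ?_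
      refine (norm_add_le _ _).trans ?_
      rw [CStarRing.norm_star_mul_self, CStarRing.norm_self_mul_star]
      have := mul_self_le_mul_self (norm_nonneg _) (hB k)
      linarith
    _ = _ := by simp

/-! ### The grading, and evenness of invariant states -/

namespace QuasiLocal

variable {A : Type*} [CStarAlgebra A] (Q : QuasiLocal A)

lemma θ_mem_loc {I : Finset ℕ} {a : A} (ha : a ∈ Q.loc I) : Q.θ a ∈ Q.loc I := by
  rw [← SetLike.mem_coe, ← Q.image_θ_loc]
  exact ⟨a, ha, rfl⟩

/-- The even part of an element. -/
noncomputable def evenPart (a : A) : A := (2⁻¹ : ℂ) • (a + Q.θ a)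

/-- The odd part of an element. -/
noncomputable def oddPart (a : A) : A := (2⁻¹ : ℂ) • (a - Q.θ a)

lemma evenPart_add_oddPart (a : A) : Q.evenPart a + Q.oddPart a = a := by
  rw [evenPart, oddPart]; module

lemma θ_evenPart (a : A) : Q.θ (Q.evenPart a) = Q.evenPart a := by
  rw [evenPart, map_smul, map_add, Q.θ_θ, add_comm]

lemma θ_oddPart (a : A) : Q.θ (Q.oddPart a) = -Q.oddPart a := by
  rw [oddPart, map_smul, map_sub, Q.θ_θ, ← smul_neg, neg_sub]

variable {Q} in
lemma evenPart_mem {I : Finset ℕ} {a : A} (ha : a ∈ Q.loc I) : Q.evenPart a ∈ Q.loc I :=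
  (Q.loc I).smul_mem (add_mem ha (Q.θ_mem_loc ha)) _

variable {Q} in
lemma oddPart_mem {I : Finset ℕ} {a : A} (ha : a ∈ Q.loc I) : Q.oddPart a ∈ Q.loc I :=
  (Q.loc I).smul_mem (sub_mem ha (Q.θ_mem_loc ha)) _

variable {I J : Finset ℕ} {x y : A}

lemma commute_of_even (hIJ : Disjoint I J) (hx : x ∈ Q.loc I) (hy : y ∈ Q.loc J)
    (he : Q.θ x = x) : x * y = y * x := by
  rw [← Q.evenPart_add_oddPart y, mul_add, add_mul,
    Q.even_commute I J hIJ x hx _ (evenPart_mem hy) he (.inl (Q.θ_evenPart y)),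
    Q.even_commute I J hIJ x hx _ (oddPart_mem hy) he (.inr (Q.θ_oddPart y))]

/-- The twist by `θ` absorbs the sign; on the GNS space it makes `π(x)W` commute with `π(y)`. -/
lemma mul_θ_of_odd (hIJ : Disjoint I J) (hx : x ∈ Q.loc I) (hy : y ∈ Q.loc J)
    (ho : Q.θ x = -x) : x * Q.θ y = y * x := by
  conv_lhs => rw [← Q.evenPart_add_oddPart y]
  conv_rhs => rw [← Q.evenPart_add_oddPart y]
  rw [map_add, θ_evenPart, θ_oddPart, mul_add, add_mul, mul_neg,
    ← Q.commute_of_even hIJ.symm (evenPart_mem hy) hx (Q.θ_evenPart y),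
    Q.odd_anticommute I J hIJ x hx _ (oddPart_mem hy) ho (Q.θ_oddPart y), neg_neg]

variable [PartialOrder A] [StarOrderedRing A] {Q}
  {α : finitePerm →* (A ≃⋆ₐ[ℂ] A)} {ω : A →ₚ[ℂ] ℂ}

lemma map_eq_zero_of_odd (hα : Q.IsLocalAction α) (hinv : ∀ σ a, ω (α σ a) = ω a)
    (hx : x ∈ Q.loc I) (ho : Q.θ x = -x) : ω x = 0 := by
  obtain ⟨N, hN⟩ : ∃ N, ∀ i ∈ I, i < N :=
    ⟨I.sup id + 1, fun i hi => Nat.lt_succ_of_le (Finset.le_sup (f := id) hi)⟩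
  have hk : ∀ k, k * N = 0 ∨ N ≤ k * N := fun k => by
    rcases k.eq_zero_or_pos with rfl | hk
    · simp
    · exact .inr (Nat.le_mul_of_pos_left N hk)
  let σ : ℕ → finitePerm := fun k => blockSwap N (k * N) (hk k)
  let z : ℕ → A := fun k => α (σ k) x
  have hz : ∀ k, z k ∈ Q.loc (I.map (σ k : Equiv.Perm ℕ).toEmbedding) := fun k => by
    rw [← SetLike.mem_coe, ← hα.image_loc]
    exact ⟨x, hx, rfl⟩
  have hzo : ∀ k, Q.θ (z k) = -z k := fun k => by
    rw [← hα.equivariant, ho, map_neg]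
  obtain ⟨C, hC⟩ := exists_norm_apply_le ω
  have hsum := norm_sum_sq_le_of_anticommute z ‖x‖
    (fun k => (StarAlgEquiv.norm_map (α (σ k)) x).le) fun k l hkl =>
      Q.odd_anticommute _ _ (disjoint_map_blockSwap hkl hN (hk k) (hk l)) _
        (star_mem (hz k)) _ (hz l) (by rw [map_star, hzo, star_neg]) (hzo l)
  -- By invariance `ω` takes the value `n * ω x` on the sum of `n` translates, whose norm is at most
  -- `√(2n) ‖x‖`.
  have hbound : ∀ n : ℕ, (n : ℝ) * ‖ω x‖ ^ 2 ≤ C ^ 2 * (2 * ‖x‖ ^ 2) := fun n => by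
    rcases n.eq_zero_or_pos with rfl | hn
    · simp; positivity
    have h1 : ω (∑ k ∈ Finset.range n, z k) = n * ω x := by
      simp [map_sum, z, hinv]
    have h2 := hC (∑ k ∈ Finset.range n, z k)
    rw [h1, norm_mul, Complex.norm_natCast] at h2
    have h3 := pow_le_pow_left₀ (by positivity) h2 2
    rw [mul_pow, mul_pow] at h3
    have h4 := h3.trans (mul_le_mul_of_nonneg_left (hsum n) (by positivity))
    have hn' : (0 : ℝ) < n := by exact_mod_cast hn
    refine le_of_mul_le_mul_left ?_ hn'
    linarith
  by_contra hne
  have hpos : 0 < ‖ω x‖ ^ 2 := by positivity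
  obtain ⟨n, hn⟩ := exists_nat_gt (C ^ 2 * (2 * ‖x‖ ^ 2) / ‖ω x‖ ^ 2)
  rw [div_lt_iff₀ hpos] at hn
  exact (hbound n).not_gt hn

/-- Invariant states are even. -/
lemma map_θ_of_invariant (hα : Q.IsLocalAction α) (hinv : ∀ σ a, ω (α σ a) = ω a) (a : A) :
    ω (Q.θ a) = ω a := by
  have hθ : Continuous Q.θ := (StarAlgEquiv.isometry Q.θ).continuous
  have hω : Continuous ω := map_continuous ω
  refine Q.dense_loc.induction (P := fun a => ω (Q.θ a) = ω a) (fun a ha => ?_)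
    (isClosed_eq (hω.comp hθ) hω) a
  obtain ⟨I, hI⟩ := Set.mem_iUnion.mp ha
  have h := map_eq_zero_of_odd hα hinv (oddPart_mem hI) (Q.θ_oddPart a)
  rw [oddPart, map_smul, map_sub, smul_eq_zero] at h
  exact (sub_eq_zero.mp (h.resolve_left (by norm_num))).symm

end QuasiLocal

/-! ### Commutation with the tail algebra -/

section VonNeumannCommute

variable {H : Type*} [NormedAddCommGroup H] [InnerProductSpace ℂ H] [CompleteSpace H]

lemma commute_of_mem_vonNeumannGenerated {S : Set (H →L[ℂ] H)} {X T : H →L[ℂ] H}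
    (hT : T ∈ vonNeumannGenerated S) (hX : ∀ s ∈ S, Commute X s)
    (hX' : ∀ s ∈ S, Commute X (star s)) : Commute X T := by
  have hT' : T ∈ StarSubalgebra.centralizer ℂ
    (StarSubalgebra.centralizer ℂ S : Set (H →L[ℂ] H)) := hT
  rw [StarSubalgebra.mem_centralizer_iff] at hT'
  refine (hT' X ?_).1
  rw [SetLike.mem_coe, StarSubalgebra.mem_centralizer_iff]
  exact fun s hs => ⟨(hX s hs).eq.symm, (hX' s hs).eq.symm⟩

end VonNeumannCommute

namespace QuasiLocal

variable {A : Type*} [CStarAlgebra A] [PartialOrder A] [StarOrderedRing A] {Q : QuasiLocal A}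
  {α : finitePerm →* (A ≃⋆ₐ[ℂ] A)} {ω : A →ₚ[ℂ] ℂ}

/-- The cutoff `n` is free: a large one avoids a given finite set, while `n = 0` shows that the tail
algebra commutes with `π(A)'`. -/
lemma commute_of_mem_tailAlgebra {X T : ω.GNS →L[ℂ] ω.GNS} (hT : T ∈ Q.tailAlgebra ω) (n : ℕ)
    (hX : ∀ J : Finset ℕ, (∀ j ∈ J, n ≤ j) → ∀ a ∈ Q.loc J, Commute X (ω.gnsStarAlgHom a)) :
    Commute X T := by
  have hT' : T ∈ ⨅ n, (vonNeumannGenerated (⋃ (I : Finset ℕ) (_ : ∀ i ∈ I, n ≤ i),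
      (vonNeumannGenerated (ω.gnsStarAlgHom '' (Q.loc I : Set A)) :
        Set (ω.GNS →L[ℂ] ω.GNS)))).toStarSubalgebra := hT
  have hTn := StarSubalgebra.mem_iInf.mp hT' n
  have key : ∀ s ∈ ⋃ (I : Finset ℕ) (_ : ∀ i ∈ I, n ≤ i),
      (vonNeumannGenerated (ω.gnsStarAlgHom '' (Q.loc I : Set A)) :
        Set (ω.GNS →L[ℂ] ω.GNS)), Commute X s ∧ Commute X (star s) := by
    intro s hs
    simp only [Set.mem_iUnion] at hs
    obtain ⟨J, hJ, hs⟩ := hs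
    have h : ∀ s ∈ vonNeumannGenerated (ω.gnsStarAlgHom '' (Q.loc J : Set A)), Commute X s := by
      intro s hs
      refine commute_of_mem_vonNeumannGenerated hs ?_ ?_
      · rintro _ ⟨a, ha, rfl⟩
        exact hX J hJ a ha
      · rintro _ ⟨a, ha, rfl⟩
        rw [← map_star]
        exact hX J hJ _ (star_mem ha)
    exact ⟨h s hs, h _ (star_mem hs)⟩
  exact commute_of_mem_vonNeumannGenerated hTn (fun s hs => (key s hs).1) fun s hs => (key s hs).2

lemma commute_gns_of_loc {X : ω.GNS →L[ℂ] ω.GNS}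
    (hX : ∀ I, ∀ a ∈ Q.loc I, Commute X (ω.gnsStarAlgHom a)) (a : A) :
    Commute X (ω.gnsStarAlgHom a) := by
  have hπ : Continuous ω.gnsStarAlgHom := map_continuous _
  refine Q.dense_loc.induction (P := fun a => Commute X (ω.gnsStarAlgHom a)) (fun a ha => ?_)
    (isClosed_eq (continuous_const.mul hπ) (hπ.mul continuous_const)) a
  obtain ⟨I, hI⟩ := Set.mem_iUnion.mp ha
  exact hX I a hI

lemma commute_gns_of_homogeneous {X : ω.GNS →L[ℂ] ω.GNS}
    (he : ∀ I, ∀ a ∈ Q.loc I, Q.θ a = a → Commute X (ω.gnsStarAlgHom a))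
    (ho : ∀ I, ∀ a ∈ Q.loc I, Q.θ a = -a → Commute X (ω.gnsStarAlgHom a)) (a : A) :
    Commute X (ω.gnsStarAlgHom a) := by
  refine commute_gns_of_loc (Q := Q) (fun I a ha => ?_) a
  rw [← Q.evenPart_add_oddPart a, map_add]
  exact (he I _ (evenPart_mem ha) (Q.θ_evenPart a)).add_right
    (ho I _ (oddPart_mem ha) (Q.θ_oddPart a))

lemma exists_disjoint_bound (I : Finset ℕ) :
    ∃ n, ∀ J : Finset ℕ, (∀ j ∈ J, n ≤ j) → Disjoint I J := by
  refine ⟨I.sup id + 1, fun J hJ => Finset.disjoint_left.mpr fun i hi hi' => ?_⟩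
  have h1 := hJ i hi'
  have h2 : i ≤ I.sup id := Finset.le_sup (f := id) hi
  omega

lemma commute_even_of_mem_tailAlgebra {T : ω.GNS →L[ℂ] ω.GNS} (hT : T ∈ Q.tailAlgebra ω)
    {I : Finset ℕ} {x : A} (hx : x ∈ Q.loc I) (he : Q.θ x = x) :
    Commute T (ω.gnsStarAlgHom x) := by
  obtain ⟨n, hn⟩ := exists_disjoint_bound I
  refine (commute_of_mem_tailAlgebra hT n fun J hJ a ha => ?_).symm
  rw [commute_iff_eq, ← map_mul, ← map_mul, Q.commute_of_even (hn J hJ) hx ha he]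

lemma commute_odd_mul_of_mem_tailAlgebra (hθ : ∀ a, ω (Q.θ a) = ω a)
    {T : ω.GNS →L[ℂ] ω.GNS} (hT : T ∈ Q.tailAlgebra ω)
    {I : Finset ℕ} {x : A} (hx : x ∈ Q.loc I) (ho : Q.θ x = -x) :
    Commute T (ω.gnsStarAlgHom x * ω.covariance Q.θ hθ) := by
  obtain ⟨n, hn⟩ := exists_disjoint_bound I
  refine (commute_of_mem_tailAlgebra hT n fun J hJ a ha => ?_).symm
  rw [commute_iff_eq, mul_assoc, covariance_mul_gnsStarAlgHom, ← mul_assoc, ← map_mul,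
    Q.mul_θ_of_odd (hn J hJ) hx ha ho, map_mul, mul_assoc]

lemma commute_covariance_of_mem_tailAlgebra (hα : Q.IsLocalAction α)
    (hinv : ∀ σ a, ω (α σ a) = ω a) {T : ω.GNS →L[ℂ] ω.GNS} (hT : T ∈ Q.tailAlgebra ω)
    (σ : finitePerm) : Commute T (ω.covariance (α σ) (hinv σ)) := by
  obtain ⟨s, hs⟩ : ∃ s, ∀ n, s ≤ n → (σ : Equiv.Perm ℕ) n = n := by
    obtain ⟨b, hb⟩ := Set.Finite.bddAbove (s := {n | (σ : Equiv.Perm ℕ) n ≠ n}) σ.2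
    refine ⟨b + 1, fun n hn => by_contra fun h => ?_⟩
    have := hb h
    omega
  refine (commute_of_mem_tailAlgebra hT s fun J hJ a ha => ?_).symm
  rw [commute_iff_eq, covariance_mul_gnsStarAlgHom, hα.trivial_of_fixed σ s hs J hJ a ha]

/-- Selfadjoint elements of the tail algebra of an extremal symmetric state are scalars. -/
lemma exists_eq_smul_one_of_mem_tailAlgebra (hα : Q.IsLocalAction α)
    (hω : ω.toLinearMap ∈ Set.extremePoints ℝ (symmetricStates α))
    {T : ω.GNS →L[ℂ] ω.GNS} (hT : T ∈ Q.tailAlgebra ω) (hsa : IsSelfAdjoint T) :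
    ∃ c : ℂ, T = c • 1 := by
  have hinv : ∀ σ a, ω (α σ a) = ω a := hω.1.2.2
  have hθ : ∀ a, ω (Q.θ a) = ω a := map_θ_of_invariant hα hinv
  set W := ω.covariance Q.θ hθ with hW
  have hWW : W * W = 1 := covariance_mul_self hθ Q.θ_θ
  have hWsa : IsSelfAdjoint W := isSelfAdjoint_covariance hθ Q.θ_θ
  have hcancel : ∀ X : ω.GNS →L[ℂ] ω.GNS, X * W * W = X := fun X => by
    rw [mul_assoc, hWW, mul_one]
  have hcancel' : ∀ X : ω.GNS →L[ℂ] ω.GNS, W * (W * X) = X := fun X => by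
    rw [← mul_assoc, hWW, one_mul]
  have hWπ : ∀ a, W * ω.gnsStarAlgHom a = ω.gnsStarAlgHom (Q.θ a) * W :=
    covariance_mul_gnsStarAlgHom hθ
  -- Conjugation by `W` carries the commutation relations of `T` over to `WTW`.
  have conj : ∀ X, Commute T (W * X * W) → Commute (W * T * W) X := fun X h => by
    rw [commute_iff_eq] at h ⊢
    have h' := congrArg (fun Y => W * Y * W) h
    simp only [mul_assoc, hWW, mul_one, hcancel'] at h' ⊢
    exact h'
  have hVsa : IsSelfAdjoint (W * T * W) := by
    rw [IsSelfAdjoint, star_mul, star_mul, hsa.star_eq, hWsa.star_eq, mul_assoc]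
  have hTe := fun I x (hx : x ∈ Q.loc I) he => commute_even_of_mem_tailAlgebra hT hx he
  have hTo := fun I x (hx : x ∈ Q.loc I) ho => commute_odd_mul_of_mem_tailAlgebra hθ hT hx ho
  have hTU := commute_covariance_of_mem_tailAlgebra hα hinv hT
  have hVe : ∀ I, ∀ x ∈ Q.loc I, Q.θ x = x → Commute (W * T * W) (ω.gnsStarAlgHom x) :=
    fun I x hx he => conj _ <| by
      rw [hWπ, he, hcancel]
      exact hTe I x hx he
  have hVo : ∀ I, ∀ x ∈ Q.loc I, Q.θ x = -x → Commute (W * T * W) (ω.gnsStarAlgHom x * W) :=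
    fun I x hx ho => conj _ <| by
      rw [← mul_assoc, hWπ, ho, map_neg, hcancel, neg_mul]
      exact (hTo I x hx ho).neg_right
  -- the odd part vanishes
  have hD : T - W * T * W = 0 := by
    set D := T - W * T * W with hD
    have hDsa : IsSelfAdjoint D := hsa.sub hVsa
    have hWD : W * D = -(D * W) := by
      rw [hD, mul_sub, sub_mul, hcancel, mul_assoc W T W, hcancel', neg_sub]
    have hDW : ∀ a, Commute (D * W) (ω.gnsStarAlgHom a) := by
      refine commute_gns_of_homogeneous (Q := Q) (fun I x hx he => ?_) fun I x hx ho => ?_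
      · refine ((hTe I x hx he).sub_left (hVe I x hx he)).mul_left ?_
        rw [commute_iff_eq, hWπ, he]
      -- For odd `x`, two signs cancel: `DWπ(x) = -Dπ(x)W = -π(x)WD = π(x)DW`.
      · have h := ((hTo I x hx ho).sub_left (hVo I x hx ho)).eq
        rw [commute_iff_eq, mul_assoc, hWπ, ho, map_neg, neg_mul, mul_neg, h, mul_assoc, hWD,
          mul_neg, neg_neg]
    have hTD : Commute T (D * W) :=
      (commute_of_mem_tailAlgebra hT 0 fun _ _ a _ => hDW a).symm
    have hVD : Commute (W * T * W) (D * W) := conj _ <| by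
      rw [← mul_assoc, hcancel, hWD]
      exact hTD.neg_right
    -- `D` commutes with `DW` yet anticommutes with `W`, so `D²W` equals its own negative.
    have hDD : D * (D * W) = D * W * D := (hTD.sub_left hVD).eq
    have h2 : D * D * W = 0 := by
      have h : D * D * W = -(D * D * W) := by
        nth_rw 1 [mul_assoc]
        rw [hDD, mul_assoc, hWD, mul_neg, mul_assoc]
      have h' : (2 : ℂ) • (D * D * W) = 0 := by rw [two_smul, ← eq_neg_iff_add_eq_zero]; exact h
      exact (smul_eq_zero.mp h').resolve_left two_ne_zero
    have h3 : D * D = 0 := by rw [← hcancel (D * D), h2, zero_mul]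
    nth_rw 1 [← hDsa.star_eq] at h3
    exact (CStarRing.star_mul_self_eq_zero_iff D).mp h3
  have hTW : Commute T W := by
    rw [commute_iff_eq]
    nth_rw 1 [sub_eq_zero.mp hD]
    rw [hcancel]
  refine exists_eq_smul_one_of_extremal hω hinv hsa
    (commute_gns_of_homogeneous hTe fun I x hx ho => ?_) hTU
  -- Since `W² = 1`, multiplying `π(x)W` by `W` recovers `π(x)`.
  have h := (hTo I x hx ho).mul_right hTW
  rwa [← hW, hcancel] at h

end QuasiLocal

/-! ### Reduction to selfadjoint elements -/

theorem mainTheorem12 {A : Type*} [CStarAlgebra A] [PartialOrder A] [StarOrderedRing A]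
    (Q : QuasiLocal A) (α : finitePerm →* (A ≃⋆ₐ[ℂ] A)) (hα : Q.IsLocalAction α)
    (ω : A →ₚ[ℂ] ℂ) (hω : ω.toLinearMap ∈ Set.extremePoints ℝ (symmetricStates α)) :
    (Q.tailAlgebra ω : Set (ω.GNS →L[ℂ] ω.GNS)) = Set.range (fun c : ℂ => c • 1) := by
  refine Set.Subset.antisymm (fun T hT => ?_) ?_
  · have hT : T ∈ (Q.tailAlgebra ω).toStarSubalgebra := hT
    have hre : (realPart T : ω.GNS →L[ℂ] ω.GNS) ∈ (Q.tailAlgebra ω).toStarSubalgebra := by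
      rw [realPart_apply_coe, ← Complex.coe_smul]
      exact SMulMemClass.smul_mem _ (add_mem hT (star_mem hT))
    have him : (imaginaryPart T : ω.GNS →L[ℂ] ω.GNS) ∈ (Q.tailAlgebra ω).toStarSubalgebra := by
      rw [imaginaryPart_apply_coe, ← Complex.coe_smul]
      exact SMulMemClass.smul_mem _ (SMulMemClass.smul_mem _ (sub_mem hT (star_mem hT)))
    obtain ⟨c, hc⟩ := QuasiLocal.exists_eq_smul_one_of_mem_tailAlgebra hα hω hre (realPart T).2
    obtain ⟨d, hd⟩ := QuasiLocal.exists_eq_smul_one_of_mem_tailAlgebra hα hω him (imaginaryPart T).2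
    refine ⟨c + Complex.I * d, ?_⟩
    rw [← realPart_add_I_smul_imaginaryPart T, hc, hd, smul_smul, ← add_smul]
  · rintro _ ⟨c, rfl⟩
    exact SMulMemClass.smul_mem (S := StarSubalgebra ℂ (ω.GNS →L[ℂ] ω.GNS))
      (s := (Q.tailAlgebra ω).toStarSubalgebra) c (one_mem _)
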